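/- Definitions. For a sequence $(u_j)_{j\in\mathbb N}$ in an additively written commutative group $A$, the IP-set generated by $(u_j)$ is $\{\sum_{j\in\gamma}u_j:\ \gamma\subset\mathbb N,\ 0<|\gamma|<\infty\}$. A subset of $A$ is an IP*-set if it has non-empty intersection with every IP-set in $A$. Let $G$ be a ring (not necessarily commutative, not necessarily with $1$). A mapping $P=(p_1,\dots,p_t):G^n\to G^t$ is polynomial if each $p_i:G^n\to G$ is a polynomial over $G$, i.e. is obtained from constants and the coordinate functions $x_1,\dots,x_n$ by finitely many additions, subtractions and multiplications. A mapping $\mathbb Z^t\to\mathbb Z^m$ (in (b) and (c)) is polynomial if each of its components is given by a polynomial with rational coefficients. A mapping $P:W\to V$ of vector spaces over a field $\mathbf K$ is polynomial if $P(w)=\sum_{k=0}^{d}M_k(w,\dots,w)$ for some $d$ and some $k$-linear mappings $M_k:W^k\to V$ over $\mathbf K$. (a) Let $G$ be a ring and let $P:G^n\to G^t$ be a polynomial mapping with $P(0)=0$. Given a finite set $F\subset G^n$ and a finite coloring $\chi:G^t\to\{1,\dots,r\}$, there is a color $l$, $1\le l\le r$, such that $$\{(x_1,\dots,x_n)\in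 G^n:\ \exists h\in G^t\ \ \forall (v_1,\dots,v_n)\in F\quad \chi\big(h+P(x_1v_1,\dots,x_nv_n)\big)=l\}$$ is an IP*-set in $G^n$. It covers the following results. (b) Let $P:\mathbb Z^t\to\mathbb Z^m$ be a polynomial mapping with $P(0)=0$, $F\subset\mathbb Z^t$ a finite set, $(u_j)_{j\in\mathbb N}$ a sequence in $\mathbb Z^t$, and $n_\gamma=(n_{1,\gamma},\dots,n_{t,\gamma})=\sum_{j\in\gamma}u_j$. For any finite coloring of $\mathbb Z^m$ there exist $a\in\mathbb Z^m$ and a finite non-empty $\gamma\subset\mathbb N$ such that $\{a+P(n_{1,\gamma}v_1,\dots,n_{t,\gamma}v_t):(v_1,\dots,v_t)\in F\}$ is monochromatic. (c) For $P$ and $F$ as in (b) and any finite coloring $\chi:\mathbb Z^m\to\{1,\dots,r\}$ there is $l$, $1\le l\le r$, such that $$\{(n_1,\dots,n_t)\in\mathbb Z^t:\ \exists a\in\mathbb Z^m\ \ \forall (v_1,\dots,v_t)\in F\quad \chi\big(a+P(n_1v_1,\dots,n_tv_t)\big)=l\}$$ is an IP*-set in $\mathbb Z^t$. (d) Let $W,V$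 be vector spaces over an infinite field $\mathbf K$, $P:W\to V$ a polynomial mapping with $P(0)=0$, and $F\subset W$ a finite set. For any finite coloring $\chi:V\to\{1,\dots,r\}$ there are $a\in V$ and a nonzero $n\in\mathbf K$ such that $a+P(nF)$ is monochromatic. Moreover, there is $l$, $1\le l\le r$, such that $$\{n\in\mathbf K:\ \exists a\in V\ \ \forall v\in F\quad \chi(a+P(nv))=l\}$$ is an IP*-set in $(\mathbf K,+)$. -/

import Mathlib

/-- The IP-set generated by a sequence `u`: all sums of finitely many (at least one) terms of `u`
with distinct indices. -/
def ipSet {A : Type*} [AddCommMonoid A] (u : ℕ → A) : Set A :=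
  {x | ∃ γ : Finset ℕ, γ.Nonempty ∧ x = ∑ j ∈ γ, u j}

/-- An IP*-set: a set that meets every IP-set. -/
def IsIPStar {A : Type*} [AddCommMonoid A] (E : Set A) : Prop :=
  ∀ u : ℕ → A, (E ∩ ipSet u).Nonempty

/-- A map `G ^ n → G` is a polynomial over the (not necessarily commutative, not necessarily unital)
ring `G` if it is obtained from the constants and the coordinate functions by finitely many
additions, subtractions and multiplications. So it is a sum of monomials in the noncommuting
variables `x_1, …, x_n`, where coefficients may stand at any place in a monomial; over a
commutative unital ring these are the functions defined by the elements of `G[x_1, …, x_n]`. -/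
def IsRingPolynomial {G : Type*} [NonUnitalRing G] {n : ℕ} (p : (Fin n → G) → G) : Prop :=
  p ∈ NonUnitalSubring.closure
    ({f : (Fin n → G) → G | ∃ c : G, f = fun _ => c} ∪
      {f : (Fin n → G) → G | ∃ i : Fin n, f = fun x => x i})

/-- A polynomial mapping `G ^ n → G ^ t` over a ring `G`: every component is a polynomial. -/
def IsRingPolynomialMap {G : Type*} [NonUnitalRing G] {n t : ℕ}
    (P : (Fin n → G) → (Fin t → G)) : Prop :=
  ∀ i : Fin t, IsRingPolynomial fun x => P x i

/-- A polynomial mapping `ℤ ^ t → ℤ ^ m`: every component is given by a polynomial with rational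
coefficients (which takes integer values at the integer points). -/
def IsIntPolynomialMap {t m : ℕ} (P : (Fin t → ℤ) → (Fin m → ℤ)) : Prop :=
  ∀ i : Fin m, ∃ p : MvPolynomial (Fin t) ℚ, ∀ x : Fin t → ℤ,
    (P x i : ℚ) = MvPolynomial.eval (fun j => (x j : ℚ)) p

/-- A polynomial mapping between vector spaces of arbitrary dimension: a finite sum of homogeneous
mappings `w ↦ M (w, …, w)` with `M` a `k`-linear mapping. -/
def IsVectorPolynomialMap (K : Type*) {W V : Type*} [Field K] [AddCommGroup W] [Module K W]
    [AddCommGroup V] [Module K V] (P : W → V) : Prop :=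
  ∃ (d : ℕ) (M : (k : ℕ) → MultilinearMap K (fun _ : Fin k => W) V),
    ∀ w : W, P w = ∑ k ∈ Finset.range (d + 1), M k (fun _ => w)

/-! Over rings, lattices and vector spaces alike, the only property of polynomials needed is that
some iterated difference vanishes. Sums, products and integer-valued rational polynomials have it,
so everything reduces to polynomial van der Waerden along an IP-set for a finite family `F` of such
maps vanishing at 0.

That theorem combines colour focusing with PET induction. If `f` is translated by `y` and the focus
is moved by `-h x`, the term that must preserve colours is `f (y + x) - f y - h x`. Recurrence of
these terms lets a point focused on `s` colours gain another colour or finish the proof, so `r + 1`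
rounds suffice (`IsColorRecurrent.of_shiftFamily`). With `h` a leading term of least degree, the new
family loses that leading term and gains only ones of lower degree (`IsDominated.shiftFamily`), so
the multiset of degrees descends in a well-founded order.

A single colour good for all IP-sets comes from running one bad IP-set per colour in parallel in a
power of the group (`exists_isIPStar_of_isPolyMap`). -/

/-! ### Polynomial maps via vanishing differences -/

/-- A map between commutative groups is polynomial of degree less than `d` if its `d`-fold
differences vanish. -/
def IsPolyDegLT {B A : Type*} [AddCommGroup B] [AddCommGroup A] : ℕ → (B → A) → Prop
  | 0, f => ∀ x, f x = 0
  | d + 1, f => ∀ y, IsPolyDegLT d fun x => f (y + x) - f x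

namespace IsPolyDegLT

variable {B A : Type*} [AddCommGroup B] [AddCommGroup A]

theorem zero (d : ℕ) : IsPolyDegLT d fun _ : B => (0 : A) := by
  induction d with
  | zero => exact fun _ => rfl
  | succ d ih => intro y; simpa using ih

theorem succ {d : ℕ} {f : B → A} (hf : IsPolyDegLT d f) : IsPolyDegLT (d + 1) f := by
  induction d generalizing f with
  | zero => intro y x; simp only [hf x, hf (y + x), sub_zero]
  | succ d ih => exact fun y => ih (hf y)

theorem mono {d e : ℕ} (h : d ≤ e) {f : B → A} (hf : IsPolyDegLT d f) : IsPolyDegLT e f := by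
  induction h with
  | refl => exact hf
  | step _ ih => exact ih.succ

theorem add {d : ℕ} {f g : B → A} (hf : IsPolyDegLT d f) (hg : IsPolyDegLT d g) :
    IsPolyDegLT d fun x => f x + g x := by
  induction d generalizing f g with
  | zero => intro x; simp only [hf x, hg x, add_zero]
  | succ d ih =>
    intro y
    convert ih (hf y) (hg y) using 2
    beta_reduce
    abel

theorem neg {d : ℕ} {f : B → A} (hf : IsPolyDegLT d f) : IsPolyDegLT d fun x => -f x := by
  induction d generalizing f with
  | zero => intro x; simp only [hf x, neg_zero]
  | succ d ih =>
    intro y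
    convert ih (hf y) using 2
    beta_reduce
    abel

theorem sub {d : ℕ} {f g : B → A} (hf : IsPolyDegLT d f) (hg : IsPolyDegLT d g) :
    IsPolyDegLT d fun x => f x - g x := by
  simpa only [sub_eq_add_neg] using hf.add hg.neg

theorem const (c : A) : IsPolyDegLT 1 fun _ : B => c := fun _ _ => sub_self c

/-- Subtracting the value at `0` does not raise the degree. -/
theorem sub_apply_zero {d : ℕ} {f : B → A} (hf : IsPolyDegLT d f) :
    IsPolyDegLT d fun x => f x - f 0 := by
  cases d with
  | zero => intro x; simp only [hf x, hf 0, sub_zero]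
  | succ d => exact hf.sub ((const _).mono (by omega))

theorem addMonoidHom (φ : B →+ A) : IsPolyDegLT 2 φ := by
  intro y z x
  simp

theorem comp {C : Type*} [AddCommGroup C] {d : ℕ} {f : B → A} (hf : IsPolyDegLT d f)
    (φ : C →+ B) : IsPolyDegLT d fun x => f (φ x) := by
  induction d generalizing f with
  | zero => exact fun x => hf (φ x)
  | succ d ih =>
    intro y
    simpa using ih (hf (φ y))

/-- Lets an integer-valued polynomial be analysed over `ℚ`, where its coefficients live. -/
theorem of_comp_injective {C : Type*} [AddCommGroup C] {d : ℕ} {f : B → A} {φ : A →+ C}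
    (hφ : Function.Injective φ) (hf : IsPolyDegLT d fun x => φ (f x)) : IsPolyDegLT d f := by
  induction d generalizing f with
  | zero => exact fun x => hφ (by simpa using hf x)
  | succ d ih => exact fun y => ih (by simpa using hf y)

theorem pi {ι : Type*} {d : ℕ} {f : B → ι → A} (hf : ∀ i, IsPolyDegLT d fun x => f x i) :
    IsPolyDegLT d f := by
  induction d generalizing f with
  | zero => exact fun x => funext fun i => hf i x
  | succ d ih => exact fun y => ih fun i => hf i y

/-- Biadditive images of polynomial maps are polynomial. -/
theorem biadditive {A' C : Type*} [AddCommGroup A'] [AddCommGroup C] (m : A →+ A' →+ C)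
    {d e n : ℕ} (hn : d + e ≤ n) {f : B → A} {g : B → A'} (hf : IsPolyDegLT d f)
    (hg : IsPolyDegLT e g) : IsPolyDegLT n fun x => m (f x) (g x) := by
  induction n generalizing d e f g with
  | zero =>
    obtain rfl : d = 0 := by omega
    intro x
    simp only [hf x, map_zero, AddMonoidHom.zero_apply]
  | succ n ih =>
    rcases d with _ | d
    · have : (fun x => m (f x) (g x)) = fun _ => 0 := by
        funext x
        simp only [hf x, map_zero, AddMonoidHom.zero_apply]
      rw [this]
      exact zero _
    rcases e with _ | e
    · have : (fun x => m (f x) (g x)) = fun _ => 0 := by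
        funext x
        simp only [hg x, map_zero]
      rw [this]
      exact zero _
    intro y
    -- Leibniz rule: Δm(f, g) = m(Δf, g) + m(f, Δg) + m(Δf, Δg), each term having smaller total
    -- degree.
    have h1 := ih (by omega) (hf y) hg
    have h2 := ih (by omega) hf (hg y)
    have h3 := ih (by omega) (hf y) (hg y)
    convert (h1.add h2).add h3 using 2
    simp only [map_sub, AddMonoidHom.sub_apply]
    abel

end IsPolyDegLT

/-- A map between commutative groups is polynomial if it is polynomial of some degree. -/
def IsPolyMap {B A : Type*} [AddCommGroup B] [AddCommGroup A] (f : B → A) : Prop :=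
  ∃ d, IsPolyDegLT d f

namespace IsPolyMap

variable {B A : Type*} [AddCommGroup B] [AddCommGroup A]

theorem const (c : A) : IsPolyMap fun _ : B => c := ⟨1, .const c⟩

theorem addMonoidHom (φ : B →+ A) : IsPolyMap φ := ⟨2, .addMonoidHom φ⟩

theorem add {f g : B → A} : IsPolyMap f → IsPolyMap g → IsPolyMap fun x => f x + g x :=
  fun ⟨d, hf⟩ ⟨e, hg⟩ => ⟨max d e, (hf.mono (le_max_left d e)).add (hg.mono (le_max_right d e))⟩

theorem neg {f : B → A} : IsPolyMap f → IsPolyMap fun x => -f x := fun ⟨d, hf⟩ => ⟨d, hf.neg⟩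

theorem biadditive {A' C : Type*} [AddCommGroup A'] [AddCommGroup C] (m : A →+ A' →+ C)
    {f : B → A} {g : B → A'} :
    IsPolyMap f → IsPolyMap g → IsPolyMap fun x => m (f x) (g x) :=
  fun ⟨_, hf⟩ ⟨_, hg⟩ => ⟨_, hf.biadditive m le_rfl hg⟩

theorem mul {R : Type*} [NonUnitalRing R] {f g : B → R} (hf : IsPolyMap f) (hg : IsPolyMap g) :
    IsPolyMap fun x => f x * g x :=
  hf.biadditive AddMonoidHom.mul hg

theorem sum {ι : Type*} (s : Finset ι) {f : ι → B → A} (hf : ∀ i ∈ s, IsPolyMap (f i)) :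
    IsPolyMap fun x => ∑ i ∈ s, f i x := by
  classical
  induction s using Finset.induction_on with
  | empty => simpa using const (0 : A)
  | insert i s hi ih =>
    simp only [Finset.sum_insert hi]
    exact (hf i (Finset.mem_insert_self i s)).add
      (ih fun j hj => hf j (Finset.mem_insert_of_mem hj))

theorem comp {C : Type*} [AddCommGroup C] {f : B → A} (φ : C →+ B) :
    IsPolyMap f → IsPolyMap fun x => f (φ x) :=
  fun ⟨d, hf⟩ => ⟨d, hf.comp φ⟩

theorem of_comp_injective {C : Type*} [AddCommGroup C] {f : B → A} {φ : A →+ C}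
    (hφ : Function.Injective φ) : (IsPolyMap fun x => φ (f x)) → IsPolyMap f :=
  fun ⟨d, hf⟩ => ⟨d, hf.of_comp_injective hφ⟩

theorem pi {ι : Type*} [Finite ι] {f : B → ι → A} (hf : ∀ i, IsPolyMap fun x => f x i) :
    IsPolyMap f := by
  have := Fintype.ofFinite ι
  choose d hd using hf
  exact ⟨Finset.univ.sup d, .pi fun i => (hd i).mono (Finset.le_sup (Finset.mem_univ i))⟩

end IsPolyMap

/-! ### Colour focusing -/

theorem ipSet_tail {B : Type*} [AddCommMonoid B] {u : ℕ → B} {M : ℕ} {x : B}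
    (hx : x ∈ ipSet fun j => u (j + M)) : x ∈ ipSet u := by
  obtain ⟨γ, hγ, rfl⟩ := hx
  exact ⟨γ.map (addRightEmbedding M), hγ.map, by simp⟩

/-- Past all indices used by the finite set `Γ`, supports are disjoint, so the sums remain sums over
distinct indices. -/
theorem exists_tail_add_mem_ipSet {B : Type*} [AddCommMonoid B] {u : ℕ → B} {Γ : Set B}
    (hΓ : Γ.Finite) (hu : Γ ⊆ ipSet u) :
    ∃ M, ∀ y ∈ Γ, ∀ x ∈ ipSet fun j => u (j + M), y + x ∈ ipSet u := by
  have key : ∀ y ∈ Γ, ∃ M₀, ∀ M ≥ M₀, ∀ x ∈ ipSet (fun j => u (j + M)), y + x ∈ ipSet u := by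
    intro y hy
    obtain ⟨γ, hγ, rfl⟩ := hu hy
    refine ⟨γ.sup id + 1, ?_⟩
    rintro M hM _ ⟨δ, hδ, rfl⟩
    have hdisj : Disjoint γ (δ.map (addRightEmbedding M)) := by
      rw [Finset.disjoint_left]
      intro a ha ha'
      obtain ⟨b, -, rfl⟩ := Finset.mem_map.1 ha'
      have := Finset.le_sup (f := id) ha
      simp only [addRightEmbedding_apply, id] at this
      omega
    exact ⟨γ.disjUnion _ hdisj, by simp [hγ], by rw [Finset.sum_disjUnion]; simp⟩
  choose! m hm using key
  obtain ⟨N, hN⟩ := (hΓ.image m).bddAbove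
  exact ⟨N, fun y hy => hm y hy N (hN ⟨y, hy, rfl⟩)⟩

/-- Every `r`-colouring of `A` contains a monochromatic configuration `a, a + f x` for `f ∈ F`, with
`a` in a fixed finite set and `x` in a fixed finite subset of the IP-set of `u`. -/
def IsColorRecurrent {B A : Type*} [AddCommGroup B] [AddCommGroup A] (u : ℕ → B)
    (F : Set (B → A)) (r : ℕ) : Prop :=
  ∃ S : Set A, ∃ Γ : Set B, S.Finite ∧ Γ.Finite ∧ Γ ⊆ ipSet u ∧
    ∀ χ : A → Fin r, ∃ a ∈ S, ∃ x ∈ Γ, ∀ f ∈ F, χ (a + f x) = χ a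

section Focusing

variable {B A : Type*} [AddCommGroup B] [AddCommGroup A]

/-- The maps whose recurrence allows to refocus a configuration for `F` with parameters in `Y`
after translation by `-h`. -/
def shiftFamily (F : Set (B → A)) (h : B → A) (Y : Set B) : Set (B → A) :=
  Set.image2 (fun f y x => f (y + x) - f y - h x) F (insert 0 Y)

theorem shiftFamily_finite {F : Set (B → A)} (hF : F.Finite) (h : B → A) {Y : Set B}
    (hY : Y.Finite) : (shiftFamily F h Y).Finite :=
  hF.image2 _ (hY.insert 0)

/-- Colour each `b` by the whole pattern of `χ` on `b + S`. This changes the number of colours,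
hence the hypothesis for every `r`. -/
theorem IsColorRecurrent.exists_pattern {u : ℕ → B} {F : Set (B → A)}
    (hrec : ∀ r, IsColorRecurrent u F r) {S : Set A} (hS : S.Finite) (r : ℕ) :
    ∃ S₁ : Set A, ∃ Γ₁ : Set B, S₁.Finite ∧ Γ₁.Finite ∧ Γ₁ ⊆ ipSet u ∧
      ∀ χ : A → Fin r, ∃ b ∈ S₁, ∃ x ∈ Γ₁, ∀ f ∈ F, ∀ z ∈ S, χ (b + f x + z) = χ (b + z) := by
  have := hS.to_subtype
  obtain ⟨n, ⟨e⟩⟩ := Finite.exists_equiv_fin (S → Fin r)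
  obtain ⟨S₁, Γ₁, h₁, h₂, h₃, H⟩ := hrec n
  refine ⟨S₁, Γ₁, h₁, h₂, h₃, fun χ => ?_⟩
  obtain ⟨b, hb, x, hx, h⟩ := H fun b => e fun z => χ (b + z)
  exact ⟨b, hb, x, hx, fun f hf z hz => congrFun (e.injective (h f hf)) ⟨z, hz⟩⟩

/-- Induction on the number `s` of distinct colours focused at `a`. If the colour of `a` is already
among them, a monochromatic configuration is found; otherwise it becomes a new colour after
refocusing. -/
theorem exists_focused {u : ℕ → B} {F : Set (B → A)} (hF : F.Finite) (hF0 : ∀ f ∈ F, f 0 = 0)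
    (h : B → A) (hrec : ∀ Y : Set B, Y.Finite → ∀ (v : ℕ → B) (r : ℕ),
      IsColorRecurrent v (shiftFamily F h Y) r) (r s : ℕ) :
    ∃ S : Set A, ∃ Γ : Set B, S.Finite ∧ Γ.Finite ∧ Γ ⊆ ipSet u ∧
      ∀ χ : A → Fin r, (∃ a ∈ S, ∃ x ∈ Γ, ∀ f ∈ F, χ (a + f x) = χ a) ∨
        ∃ a ∈ S, ∃ C : Finset (Fin r), C.card = s ∧
          ∀ c ∈ C, ∃ x ∈ Γ, ∀ f ∈ F, χ (a + f x) = c := by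
  induction s with
  | zero =>
    exact ⟨{0}, ∅, Set.finite_singleton 0, Set.finite_empty, Set.empty_subset _,
      fun χ => .inr ⟨0, rfl, ∅, rfl, by simp⟩⟩
  | succ s ih =>
    obtain ⟨S, Γ, hS, hΓ, hΓu, H⟩ := ih
    obtain ⟨M, hM⟩ := exists_tail_add_mem_ipSet hΓ hΓu
    -- All points whose colour must survive the next translation: the foci and the configurations
    -- around them.
    set S' : Set A := S ∪ Set.image2 (fun a (g : A) => a + g) S
      (Set.image2 (fun (f : B → A) x => f x) F Γ)
    have hS' : S'.Finite := hS.union (hS.image2 _ (hF.image2 _ hΓ))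
    obtain ⟨S₁, Γ₁, hS₁, hΓ₁, hΓ₁u, H₁⟩ := IsColorRecurrent.exists_pattern
      (hrec Γ hΓ fun j => u (j + M)) hS' r
    refine ⟨Set.image2 (fun b a => b + a) S₁ S ∪
        Set.image2 (fun c x => c - h x) (Set.image2 (fun b a => b + a) S₁ S) Γ₁,
      Γ ∪ Γ₁ ∪ Set.image2 (fun y x => y + x) Γ Γ₁,
      (hS₁.image2 _ hS).union ((hS₁.image2 _ hS).image2 _ hΓ₁),
      (hΓ.union hΓ₁).union (hΓ.image2 _ hΓ₁), ?_, fun χ => ?_⟩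
    · rintro x ((hx | hx) | ⟨y, hy, x, hx, rfl⟩)
      · exact hΓu hx
      · exact ipSet_tail (hΓ₁u hx)
      · exact hM y hy x (hΓ₁u hx)
    · obtain ⟨b, hb, x, hx, hbx⟩ := H₁ χ
      have hmem : ∀ a ∈ S, b + a ∈ Set.image2 (fun b a => b + a) S₁ S :=
        fun a ha => ⟨b, hb, a, ha, rfl⟩
      rcases H fun a => χ (b + a) with ⟨a, ha, y, hy, hay⟩ | ⟨a, ha, C, hC, haC⟩
      · exact .inl ⟨b + a, .inl (hmem a ha), y, .inl (.inl hy),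
          fun f hf => by rw [add_assoc]; exact hay f hf⟩
      by_cases hc : χ (b + a) ∈ C
      · obtain ⟨y, hy, hay⟩ := haC _ hc
        exact .inl ⟨b + a, .inl (hmem a ha), y, .inl (.inl hy),
          fun f hf => by rw [add_assoc]; exact hay f hf⟩
      refine .inr ⟨b + a - h x, .inr ⟨_, hmem a ha, x, hx, rfl⟩, insert (χ (b + a)) C,
        by rw [Finset.card_insert_of_notMem hc, hC], fun c hcC => ?_⟩
      rcases Finset.mem_insert.1 hcC with rfl | hcC
      -- The parameter `y = 0` of the shift family: the new focus plus `f x` is `b + a` moved by `f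
      -- x - h x`, so it has the colour of the old focus.
      · refine ⟨x, .inl (.inr hx), fun f hf => ?_⟩
        rw [← hbx _ ⟨f, hf, 0, Set.mem_insert _ _, rfl⟩ a (.inl ha)]
        congr 1
        simp only [zero_add, hF0 f hf]
        abel
      -- An old colour persists: the new focus plus `f (y + x)` is `b + a + f y` moved by `f (y + x)
      -- - f y - h x`.
      · obtain ⟨y, hy, hay⟩ := haC c hcC
        refine ⟨y + x, .inr ⟨y, hy, x, hx, rfl⟩, fun f hf => ?_⟩
        rw [← hay f hf, ← hbx _ ⟨f, hf, y, Set.mem_insert_of_mem _ hy, rfl⟩ (a + f y)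
          (.inr ⟨a, ha, f y, ⟨f, hf, y, hy, rfl⟩, rfl⟩)]
        congr 1
        beta_reduce
        abel

/-- Pigeonhole: `r + 1` distinct focused colours cannot exist. -/
theorem IsColorRecurrent.of_shiftFamily {u : ℕ → B} {F : Set (B → A)} (hF : F.Finite)
    (hF0 : ∀ f ∈ F, f 0 = 0) (h : B → A)
    (hrec : ∀ Y : Set B, Y.Finite → ∀ (v : ℕ → B) (r : ℕ),
      IsColorRecurrent v (shiftFamily F h Y) r) (r : ℕ) : IsColorRecurrent u F r := by
  obtain ⟨S, Γ, hS, hΓ, hΓu, H⟩ := exists_focused (u := u) hF hF0 h hrec r (r + 1)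
  refine ⟨S, Γ, hS, hΓ, hΓu, fun χ => (H χ).resolve_right ?_⟩
  rintro ⟨-, -, C, hC, -⟩
  have := C.card_le_univ
  rw [Fintype.card_fin] at this
  omega

/-- The zero map imposes no condition, but it would put `-h` into the shift family, which need not
be dominated. -/
theorem IsColorRecurrent.of_diff_zero {u : ℕ → B} {F : Set (B → A)} {r : ℕ}
    (hrec : IsColorRecurrent u (F \ {0}) r) : IsColorRecurrent u F r := by
  obtain ⟨S, Γ, hS, hΓ, hΓu, H⟩ := hrec
  refine ⟨S, Γ, hS, hΓ, hΓu, fun χ => ?_⟩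
  obtain ⟨a, ha, x, hx, hax⟩ := H χ
  refine ⟨a, ha, x, hx, fun f hf => ?_⟩
  by_cases hf0 : f = 0
  · simp [hf0]
  · exact hax f ⟨hf, hf0⟩

end Focusing

/-! ### Induction on the degrees -/

section PET

variable {B A : Type*} [AddCommGroup B] [AddCommGroup A]

/-- The multiset `L` of pairs (degree bound, leading term) dominates the family `F`: each nonzero
member of `F` agrees with one of the leading terms up to lower degree. -/
structure IsDominated (F : Set (B → A)) (L : Multiset (ℕ × (B → A))) : Prop where
  apply_zero : ∀ f ∈ F, f 0 = 0
  degree : ∀ c ∈ L, IsPolyDegLT (c.1 + 1) c.2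
  leading_zero : ∀ c ∈ L, c.2 0 = 0
  exists_leading : ∀ f ∈ F, f ≠ 0 → ∃ c ∈ L, IsPolyDegLT c.1 fun x => f x - c.2 x

/-- The expression is `f - h` plus the difference of `f` in direction `y`, normalised at 0; both
have lower degree. -/
theorem IsPolyDegLT.shift_sub {d : ℕ} {f h : B → A} (hf0 : f 0 = 0)
    (hh : IsPolyDegLT (d + 1) h) (hfh : IsPolyDegLT d fun x => f x - h x) (y : B) :
    IsPolyDegLT d fun x => f (y + x) - f y - h x := by
  have hf : IsPolyDegLT (d + 1) f := by simpa using hfh.succ.add hh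
  convert hfh.add (hf y).sub_apply_zero using 2
  simp only [add_zero, hf0]
  abel

/-- Maps led by `h` drop below degree `d`. Maps led by another `c` become led by `c - h`, whose
degree bound is unchanged because `d` is minimal. -/
theorem IsDominated.shiftFamily {F : Set (B → A)} (hF : F.Finite) {d : ℕ} {h : B → A}
    {L : Multiset (ℕ × (B → A))} (hmin : ∀ c ∈ L, d ≤ c.1) (hFL : IsDominated F ((d, h) ::ₘ L))
    (hne : (0 : B → A) ∉ F) {Y : Set B} (hY : Y.Finite) :
    ∃ t : Multiset (ℕ × (B → A)), (∀ c ∈ t, c.1 < d) ∧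
      IsDominated (shiftFamily F h Y) (t + L.map fun c => (c.1, fun x => c.2 x - h x)) := by
  have hfin : {q ∈ _root_.shiftFamily F h Y | IsPolyDegLT d q ∧ q ≠ 0}.Finite :=
    (shiftFamily_finite hF h hY).subset fun _ hq => hq.1
  have hh : IsPolyDegLT (d + 1) h := hFL.degree _ (Multiset.mem_cons_self _ _)
  have hh0 : h 0 = 0 := hFL.leading_zero _ (Multiset.mem_cons_self _ _)
  have hq0 : ∀ q ∈ _root_.shiftFamily F h Y, q 0 = 0 := by
    rintro _ ⟨f, hf, y, hy, rfl⟩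
    simp [hh0]
  have hpos : ∀ q : B → A, IsPolyDegLT d q → q ≠ 0 → 0 < d := by
    intro q hq hne
    rcases d.eq_zero_or_pos with rfl | hd
    · exact absurd (funext hq) hne
    · exact hd
  -- Each nonzero member of degree less than `d` serves as its own leading term; being nonzero
  -- forces `d > 0`, so the bound `d - 1` is really smaller.
  refine ⟨hfin.toFinset.val.map fun q => (d - 1, q), ?_, hq0, ?_, ?_, ?_⟩
  · intro c hc
    obtain ⟨q, hq, rfl⟩ := Multiset.mem_map.1 hc
    have hq' := hfin.mem_toFinset.1 hq
    have := hpos q hq'.2.1 hq'.2.2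
    simp only
    omega
  · intro c hc
    rcases Multiset.mem_add.1 hc with hc | hc
    · obtain ⟨q, hq, rfl⟩ := Multiset.mem_map.1 hc
      have hq' := hfin.mem_toFinset.1 hq
      exact hq'.2.1.mono (by omega)
    · obtain ⟨c, hcL, rfl⟩ := Multiset.mem_map.1 hc
      exact (hFL.degree c (Multiset.mem_cons_of_mem hcL)).sub
        (hh.mono (Nat.succ_le_succ (hmin c hcL)))
  · intro c hc
    rcases Multiset.mem_add.1 hc with hc | hc
    · obtain ⟨q, hq, rfl⟩ := Multiset.mem_map.1 hc
      exact hq0 q (hfin.mem_toFinset.1 hq).1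
    · obtain ⟨c, hcL, rfl⟩ := Multiset.mem_map.1 hc
      simp [hFL.leading_zero c (Multiset.mem_cons_of_mem hcL), hh0]
  · intro q hq hqne
    obtain ⟨f, hf, y, hy, rfl⟩ := id hq
    obtain ⟨c, hc, hfc⟩ := hFL.exists_leading f hf fun h0 => hne (h0 ▸ hf)
    have key := IsPolyDegLT.shift_sub (hFL.apply_zero f hf) (hFL.degree c hc) hfc y
    rcases Multiset.mem_cons.1 hc with rfl | hc
    · refine ⟨_, Multiset.mem_add.2 (.inl (Multiset.mem_map.2
        ⟨_, hfin.mem_toFinset.2 ⟨hq, key, hqne⟩, rfl⟩)), ?_⟩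
      simpa using IsPolyDegLT.zero _
    · refine ⟨_, Multiset.mem_add.2 (.inr (Multiset.mem_map.2 ⟨c, hc, rfl⟩)), ?_⟩
      convert key using 2
      exact sub_sub_sub_cancel_right _ _ _

theorem IsDominated.isColorRecurrent {F : Set (B → A)} (hF : F.Finite)
    {L : Multiset (ℕ × (B → A))} (hFL : IsDominated F L) (u : ℕ → B) (r : ℕ) :
    IsColorRecurrent u F r := by
  -- Replacing one degree by finitely many smaller ones is a well-founded relation on multisets.
  have wf : WellFounded (Relation.CutExpand (α := ℕ) (· < ·)) := Nat.lt_wfRel.wf.cutExpand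
  induction hs : L.map Prod.fst using wf.induction generalizing F L u r with
  | _ s ih =>
  subst hs
  refine IsColorRecurrent.of_diff_zero ?_
  rcases eq_or_ne L 0 with rfl | hL
  -- With no leading terms there are no nonzero maps, and any point of the IP-set works.
  · refine ⟨{0}, {u 0}, Set.finite_singleton _, Set.finite_singleton _, ?_, fun χ => ?_⟩
    · rintro _ rfl
      exact ⟨{0}, Finset.singleton_nonempty 0, by simp⟩
    · refine ⟨0, rfl, u 0, rfl, fun f hf => ?_⟩
      obtain ⟨c, hc, -⟩ := hFL.exists_leading f hf.1 hf.2
      exact absurd hc (Multiset.notMem_zero c)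
  · classical
    obtain ⟨⟨d, h⟩, hmem, hmin⟩ := L.toFinset.exists_min_image Prod.fst
      (by simpa [Multiset.toFinset_nonempty] using hL)
    obtain ⟨L, rfl⟩ := Multiset.exists_cons_of_mem (Multiset.mem_toFinset.1 hmem)
    have hFL' : IsDominated (F \ {0}) ((d, h) ::ₘ L) :=
      ⟨fun f hf => hFL.apply_zero f hf.1, hFL.degree, hFL.leading_zero,
        fun f hf => hFL.exists_leading f hf.1⟩
    have hF' : (F \ {0}).Finite := hF.subset Set.sdiff_subset
    refine IsColorRecurrent.of_shiftFamily hF' hFL'.apply_zero h (fun Y hY v r => ?_) r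
    obtain ⟨t, ht, hdom⟩ := hFL'.shiftFamily hF'
      (fun c hc => hmin c (Multiset.mem_toFinset.2 (Multiset.mem_cons_of_mem hc)))
      (fun h0 => h0.2 rfl) hY
    refine ih _ ?_ (shiftFamily_finite hF' h hY) hdom v r rfl
    refine ⟨t.map Prod.fst, d, ?_, ?_⟩
    · intro e he
      obtain ⟨c, hc, rfl⟩ := Multiset.mem_map.1 he
      exact ht c hc
    · simp only [Multiset.map_add, Multiset.map_map, Function.comp_def, Multiset.map_cons]
      rw [add_comm (t.map Prod.fst), ← Multiset.singleton_add]
      abel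

/-- The polynomial van der Waerden theorem along IP-sets, for polynomial maps between commutative
groups. -/
theorem isColorRecurrent_of_isPolyMap {F : Set (B → A)} (hF : F.Finite)
    (hpoly : ∀ f ∈ F, IsPolyMap f) (hF0 : ∀ f ∈ F, f 0 = 0) (u : ℕ → B) (r : ℕ) :
    IsColorRecurrent u F r := by
  choose! d hd using hpoly
  refine IsDominated.isColorRecurrent hF (L := hF.toFinset.val.map fun f => (d f, f))
    ⟨hF0, ?_, ?_, ?_⟩ u r
  · intro c hc
    obtain ⟨f, hf, rfl⟩ := Multiset.mem_map.1 hc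
    exact (hd f (hF.mem_toFinset.1 hf)).succ
  · intro c hc
    obtain ⟨f, hf, rfl⟩ := Multiset.mem_map.1 hc
    exact hF0 f (hF.mem_toFinset.1 hf)
  · intro f hf _
    refine ⟨_, Multiset.mem_map.2 ⟨f, hF.mem_toFinset.2 hf, rfl⟩, ?_⟩
    simpa using IsPolyDegLT.zero _

/-! ### One colour for all IP-sets -/

/-- If every colour `l` had a bad IP-set, generated by `u l`, these sequences would form one
sequence in `Fin r → B`. Recurrence for all maps `x ↦ f (x l)` at once yields a common `γ` and a
point `a`; the colour of `a` then contradicts its own bad IP-set. -/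
theorem exists_isIPStar_of_isPolyMap {F : Set (B → A)} (hF : F.Finite)
    (hpoly : ∀ f ∈ F, IsPolyMap f) (hF0 : ∀ f ∈ F, f 0 = 0) {r : ℕ} (χ : A → Fin r) :
    ∃ l : Fin r, IsIPStar {x : B | ∃ a, ∀ f ∈ F, χ (a + f x) = l} := by
  by_contra! hcon
  simp only [IsIPStar, not_forall] at hcon
  choose u hu using hcon
  obtain ⟨S, Γ, -, -, hΓu, H⟩ := isColorRecurrent_of_isPolyMap
    (F := Set.image2 (fun (f : B → A) (l : Fin r) (x : Fin r → B) => f (x l)) F Set.univ)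
    (hF.image2 _ Set.finite_univ)
    (by rintro _ ⟨f, hf, l, -, rfl⟩
        exact (hpoly f hf).comp (Pi.evalAddMonoidHom (fun _ : Fin r => B) l))
    (by rintro _ ⟨f, hf, l, -, rfl⟩
        exact hF0 f hf)
    (fun j l => u l j) r
  obtain ⟨a, -, x, hx, hax⟩ := H χ
  obtain ⟨γ, hγ, rfl⟩ := hΓu hx
  refine hu (χ a) ⟨∑ j ∈ γ, u (χ a) j, ⟨a, fun f hf => ?_⟩, γ, hγ, rfl⟩
  simpa using hax _ ⟨f, hf, χ a, Set.mem_univ _, rfl⟩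

theorem exists_isIPStar_of_finset {W : Type*} (F : Finset W) (p : W → B → A)
    (hpoly : ∀ v, IsPolyMap (p v)) (hp0 : ∀ v, p v 0 = 0) {r : ℕ} (χ : A → Fin r) :
    ∃ l : Fin r, IsIPStar {x : B | ∃ a, ∀ v ∈ F, χ (a + p v x) = l} := by
  obtain ⟨l, hl⟩ := exists_isIPStar_of_isPolyMap (F := p '' F) (F.finite_toSet.image p)
    (by rintro _ ⟨v, -, rfl⟩; exact hpoly v) (by rintro _ ⟨v, -, rfl⟩; exact hp0 v) χ
  refine ⟨l, ?_⟩
  simpa using hl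

end PET

/-! ### The polynomial maps of rings, lattices and vector spaces -/

theorem IsRingPolynomial.isPolyMap {G : Type*} [NonUnitalRing G] {n : ℕ} {p : (Fin n → G) → G}
    (hp : IsRingPolynomial p) : IsPolyMap p := by
  induction hp using NonUnitalSubring.closure_induction with
  | mem f hf =>
    rcases hf with ⟨c, rfl⟩ | ⟨i, rfl⟩
    · exact .const c
    · exact .addMonoidHom (Pi.evalAddMonoidHom (fun _ : Fin n => G) i)
  | zero => exact .const 0
  | add _ _ _ _ hf hg => exact hf.add hg
  | neg _ _ hf => exact hf.neg
  | mul _ _ _ _ hf hg => exact hf.mul hg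

/-- Coordinatewise multiplication by a fixed vector. -/
def coordMulRight {G ι : Type*} [NonUnitalRing G] (v : ι → G) : (ι → G) →+ (ι → G) where
  toFun x i := x i * v i
  map_zero' := by ext; simp
  map_add' x y := by ext; simp [add_mul]

theorem IsIntPolynomialMap.isPolyMap {t m : ℕ} {P : (Fin t → ℤ) → (Fin m → ℤ)}
    (hP : IsIntPolynomialMap P) : IsPolyMap P := by
  refine .pi fun i => ?_
  obtain ⟨p, hp⟩ := hP i
  refine .of_comp_injective (φ := Int.castAddHom ℚ) Int.cast_injective ?_
  simp only [Int.coe_castAddHom, hp]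
  clear hp
  induction p using MvPolynomial.induction_on with
  | C c => simpa using IsPolyMap.const c
  | add p q hp hq => simpa using hp.add hq
  | mul_X p j hp =>
    simp only [map_mul, MvPolynomial.eval_X]
    exact hp.mul (.addMonoidHom
      ((Int.castAddHom ℚ).comp (Pi.evalAddMonoidHom (fun _ : Fin t => ℤ) j)))

theorem isPolyMap_pow_smul {K V : Type*} [Field K] [AddCommGroup V] [Module K V] (k : ℕ) (w : V) :
    IsPolyMap fun x : K => x ^ k • w := by
  have hpow : IsPolyMap fun x : K => x ^ k := by
    induction k with
    | zero => simpa using IsPolyMap.const (1 : K)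
    | succ k ih =>
      simp only [pow_succ]
      exact ih.mul (.addMonoidHom (AddMonoidHom.id K))
  exact hpow.biadditive (smulAddHom K V) (.const w)

theorem IsVectorPolynomialMap.isPolyMap {K W V : Type*} [Field K] [AddCommGroup W] [Module K W]
    [AddCommGroup V] [Module K V] {P : W → V} (hP : IsVectorPolynomialMap K P) (w : W) :
    IsPolyMap fun x : K => P (x • w) := by
  obtain ⟨d, M, hM⟩ := hP
  simp only [hM]
  refine .sum _ fun k _ => ?_
  simpa [MultilinearMap.map_smul_univ] using isPolyMap_pow_smul k (M k fun _ => w)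

/-- An infinite commutative group contains an IP-set without `0`. -/
theorem exists_zero_notMem_ipSet (A : Type*) [AddCommGroup A] [Infinite A] :
    ∃ u : ℕ → A, (0 : A) ∉ ipSet u := by
  -- Greedy choice: `s n` contains all nonempty sums of the first `n` generators, and the next one,
  -- `v (s n)`, avoids 0 and the negatives of `s n`, so no sum vanishes.
  classical
  choose v hv using fun s : Finset A => Infinite.exists_notMem_finset (insert 0 (s.image Neg.neg))
  let s : ℕ → Finset A := fun n =>
    Nat.rec ∅ (fun _ s => insert (v s) (s ∪ s.image (v s + ·))) n
  have hs : ∀ n, s (n + 1) = insert (v (s n)) (s n ∪ (s n).image (v (s n) + ·)) := fun _ => rfl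
  have h0 : ∀ n, (0 : A) ∉ s n := by
    intro n
    induction n with
    | zero => exact Finset.notMem_empty 0
    | succ n ih =>
      have := hv (s n)
      simp only [Finset.mem_insert, Finset.mem_image, not_or, not_exists, not_and] at this
      rw [hs]
      simp only [Finset.mem_insert, Finset.mem_union, Finset.mem_image, not_or, not_exists,
        not_and]
      exact ⟨fun h => this.1 h.symm, ih, fun a ha h => this.2 a ha (neg_eq_of_add_eq_zero_left h)⟩
  have hmem : ∀ n, ∀ γ ⊆ Finset.range n, γ.Nonempty → ∑ j ∈ γ, v (s j) ∈ s n := by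
    intro n
    induction n with
    | zero =>
      intro γ hγ hne
      simp [Finset.subset_empty.1 hγ] at hne
    | succ n ih =>
      intro γ hγ hne
      rw [Finset.range_add_one, Finset.subset_insert_iff] at hγ
      rw [hs]
      by_cases hn : n ∈ γ
      · rw [← Finset.add_sum_erase γ _ hn]
        rcases (γ.erase n).eq_empty_or_nonempty with he | he
        · simp [he]
        · exact Finset.mem_insert_of_mem (Finset.mem_union_right _
            (Finset.mem_image_of_mem _ (ih _ hγ he)))
      · rw [Finset.erase_eq_of_notMem hn] at hγ
        exact Finset.mem_insert_of_mem (Finset.mem_union_left _ (ih γ hγ hne))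
  refine ⟨fun j => v (s j), ?_⟩
  rintro ⟨γ, hne, hγ⟩
  exact h0 (γ.sup id + 1) (hγ ▸ hmem _ γ
    (fun j hj => Finset.mem_range_succ_iff.2 (Finset.le_sup (f := id) hj)) hne)

theorem corollary7p14 :
    -- polynomial mappings over an arbitrary ring
    (∀ (G : Type*) [NonUnitalRing G] (n t : ℕ) (P : (Fin n → G) → (Fin t → G)),
      IsRingPolynomialMap P → P 0 = 0 →
      ∀ (F : Finset (Fin n → G)) (r : ℕ) (χ : (Fin t → G) → Fin r),
        ∃ l : Fin r, IsIPStar {x : Fin n → G |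
          ∃ h : Fin t → G, ∀ v ∈ F, χ (h + P (fun i => x i * v i)) = l}) ∧
    -- integer-valued polynomial mappings, along a given IP-set
    (∀ (t m : ℕ) (P : (Fin t → ℤ) → (Fin m → ℤ)),
      IsIntPolynomialMap P → P 0 = 0 →
      ∀ (F : Finset (Fin t → ℤ)) (u : ℕ → Fin t → ℤ) (r : ℕ) (χ : (Fin m → ℤ) → Fin r),
        ∃ (a : Fin m → ℤ) (γ : Finset ℕ), γ.Nonempty ∧
          ∃ l : Fin r, ∀ v ∈ F, χ (a + P (fun i => (∑ j ∈ γ, u j i) * v i)) = l) ∧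
    -- integer-valued polynomial mappings, with one color for all IP-sets
    (∀ (t m : ℕ) (P : (Fin t → ℤ) → (Fin m → ℤ)),
      IsIntPolynomialMap P → P 0 = 0 →
      ∀ (F : Finset (Fin t → ℤ)) (r : ℕ) (χ : (Fin m → ℤ) → Fin r),
        ∃ l : Fin r, IsIPStar {x : Fin t → ℤ |
          ∃ a : Fin m → ℤ, ∀ v ∈ F, χ (a + P (fun i => x i * v i)) = l}) ∧
    -- polynomial mappings of vector spaces over an infinite field
    (∀ (K W V : Type*) [Field K] [Infinite K] [AddCommGroup W] [Module K W]
        [AddCommGroup V] [Module K V] (P : W → V),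
      IsVectorPolynomialMap K P → P 0 = 0 →
      ∀ (F : Finset W) (r : ℕ) (χ : V → Fin r),
        (∃ (a : V) (x : K), x ≠ 0 ∧ ∃ l : Fin r, ∀ v ∈ F, χ (a + P (x • v)) = l) ∧
        ∃ l : Fin r, IsIPStar {x : K |
          ∃ a : V, ∀ v ∈ F, χ (a + P (x • v)) = l}) := by
  have int : ∀ (t m : ℕ) (P : (Fin t → ℤ) → (Fin m → ℤ)), IsIntPolynomialMap P → P 0 = 0 →
      ∀ (F : Finset (Fin t → ℤ)) (r : ℕ) (χ : (Fin m → ℤ) → Fin r),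
        ∃ l : Fin r, IsIPStar {x : Fin t → ℤ |
          ∃ a : Fin m → ℤ, ∀ v ∈ F, χ (a + P (fun i => x i * v i)) = l} :=
    fun t m P hP hP0 F r χ => exists_isIPStar_of_finset F (fun v x => P (coordMulRight v x))
      (fun v => hP.isPolyMap.comp (coordMulRight v)) (fun v => by rw [map_zero, hP0]) χ
  refine ⟨fun G _ n t P hP hP0 F r χ => ?_, fun t m P hP hP0 F u r χ => ?_, int,
    fun K W V _ _ _ _ _ _ P hP hP0 F r χ => ?_⟩
  · exact exists_isIPStar_of_finset F (fun v x => P (coordMulRight v x))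
      (fun v => (IsPolyMap.pi fun i => (hP i).isPolyMap).comp (coordMulRight v))
      (fun v => by rw [map_zero, hP0]) χ
  · obtain ⟨l, hl⟩ := int t m P hP hP0 F r χ
    obtain ⟨_, ⟨a, ha⟩, γ, hγ, rfl⟩ := hl u
    exact ⟨a, γ, hγ, l, by simpa only [Finset.sum_apply] using ha⟩
  · obtain ⟨l, hl⟩ := exists_isIPStar_of_finset F (fun v (x : K) => P (x • v))
      (fun v => hP.isPolyMap v) (fun v => by rw [zero_smul, hP0]) χ
    refine ⟨?_, l, hl⟩
    -- An IP*-set must meet this IP-set, which omits 0; this forces a nonzero parameter.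
    obtain ⟨u, hu⟩ := exists_zero_notMem_ipSet K
    obtain ⟨x, ⟨a, ha⟩, hx⟩ := hl u
    exact ⟨a, x, fun h0 => hu (h0 ▸ hx), l, ha⟩
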